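/- Let $H$ be a real Hilbert space, let $X\subseteq H$ be a non-empty closed convex set with $0\notin X$, and for $x\in H$ let $P(x)$ denote the metric projection of $x$ on $X$, that is, the unique global minimum over $X$ of $y\mapsto\|x-y\|$. For $r>0$ put $S_r=\{x\in H:\|x\|^2=r\}$. Let $(T,\mathcal F,\mu)$ be a measure space with $0<\mu(T)<+\infty$. Then, for every $\eta\in L^\infty(T)$ with $\eta\ge 0$, for every $r\in\,]0,\|P(0)\|^2[$ and for every real $p\ge 2$, if we put $$U_{\eta,r}=\left\{u\in L^p(T,H):\int_T\eta(t)\|u(t)\|^2\,d\mu=r\int_T\eta(t)\,d\mu\right\},$$ all the infima and suprema below are finite and are taken over non-empty sets, all the integrands below and in the definition of $U_{\eta,r}$ are integrable, and $$\inf_{u\in U_{\eta,r}}\int_T\eta(t)\|u(t)-P(u(t))\|^2\,d\mu=\inf_{x\in S_r}\|x-P(x)\|^2\int_T\eta(t)\,d\mu,$$ $$\sup_{u\in U_{\eta,r}}\int_T\eta(t)\|u(t)-P(u(t))\|^2\,d\mu=\sup_{x\in S_r}\|x-P(x)\|^2\int_T\eta(t)\,d\mu.$$ -/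

import Mathlib

open MeasureTheory

namespace MetricProjection

variable {H : Type*} [NormedAddCommGroup H]

/-- `p` is a global minimum over `X` of `y ↦ ‖x - y‖`. -/
def IsNearest (X : Set H) (x p : H) : Prop :=
  p ∈ X ∧ ∀ y ∈ X, ‖x - p‖ ≤ ‖x - y‖

/-- In a real Hilbert space, every point has exactly one nearest point in a given non-empty
closed convex set. -/
theorem existsUnique_isNearest [InnerProductSpace ℝ H] [CompleteSpace H] {X : Set H}
    (hne : X.Nonempty) (hcl : IsClosed X) (hconv : Convex ℝ X) (x : H) :
    ∃! p, IsNearest X x p := by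
  have key : ∀ p ∈ X, IsNearest X x p → ∀ y ∈ X, inner ℝ (x - p) (y - p) ≤ 0 := by
    intro p hp h
    have : Nonempty X := ⟨⟨p, hp⟩⟩
    refine (norm_eq_iInf_iff_real_inner_le_zero hconv hp).1 (le_antisymm ?_ ?_)
    · exact le_ciInf fun y => h.2 y y.2
    · exact ciInf_le ⟨0, by rintro _ ⟨y, rfl⟩; exact norm_nonneg _⟩ (⟨p, hp⟩ : X)
  obtain ⟨p, hp, h⟩ := exists_norm_eq_iInf_of_complete_convex hne hcl.isComplete hconv x
  have hpn : IsNearest X x p := ⟨hp, fun y hy => h.trans_le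
    (ciInf_le ⟨0, by rintro _ ⟨y, rfl⟩; exact norm_nonneg _⟩ (⟨y, hy⟩ : X))⟩
  refine ⟨p, hpn, fun q hq => ?_⟩
  have h1 := key p hp hpn q hq.1
  have h2 := key q hq.1 hq p hp
  have h3 : inner ℝ (q - p) (q - p) ≤ 0 := by
    have e : inner ℝ (q - p) (q - p) = inner ℝ (x - p) (q - p) + inner ℝ (x - q) (p - q) := by
      rw [← neg_sub q p, inner_neg_right, ← sub_eq_add_neg, ← inner_sub_left]
      congr 1
      abel
    linarith
  rw [real_inner_self_eq_norm_sq] at h3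
  exact sub_eq_zero.1 (norm_eq_zero.1 (pow_eq_zero_iff two_ne_zero |>.1
    (le_antisymm h3 (sq_nonneg _))))

open Classical in
/-- The metric projection on `X`: `proj X x` is the unique global minimum over `X` of
`y ↦ ‖x - y‖`. The value `0` is only a default for points without a unique nearest point; by
`existsUnique_isNearest` it is never used when `X` is a non-empty closed convex subset of a
Hilbert space. -/
noncomputable def proj (X : Set H) (x : H) : H :=
  if h : ∃! p, IsNearest X x p then h.choose else 0

theorem isNearest_proj [InnerProductSpace ℝ H] [CompleteSpace H] {X : Set H}
    (hne : X.Nonempty) (hcl : IsClosed X) (hconv : Convex ℝ X) (x : H) :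
    IsNearest X x (proj X x) := by
  have h := existsUnique_isNearest hne hcl hconv x
  rw [proj, dif_pos h]
  exact h.choose_spec.1

/-- The set `S_r` of all points whose squared norm is `r`. -/
def sphereSq (H : Type*) [NormedAddCommGroup H] (r : ℝ) : Set H :=
  {x | ‖x‖ ^ 2 = r}

/-- The constraint set `U_{η,r}` in `L^p(T, H)`: all `u` such that
`∫ η(t) ‖u(t)‖² dμ = r ∫ η(t) dμ`. -/
def constraintSet {T : Type*} [MeasurableSpace T] {μ : Measure T}
    (p : ℝ) (η : Lp ℝ ⊤ μ) (r : ℝ) : Set (Lp H (ENNReal.ofReal p) μ) :=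
  {u | ∫ t, η t * ‖u t‖ ^ 2 ∂μ = r * ∫ t, η t ∂μ}

end MetricProjection

/-!
Write `d = ‖P(0)‖` and `ρ = √r`, so that `0 < ρ < d`, and let `φ(x) = ‖x - P(x)‖ ^ 2` be the squared
distance to `X`. The triangle inequality gives `(d - ‖x‖) ^ 2 ≤ φ(x)` for `‖x‖ ≤ d` and
`φ(x) ≤ (d + ‖x‖) ^ 2` for all `x`. On the sphere of radius `ρ` both bounds are attained: the lower
one at `(ρ / d) • P(0)`, the upper one at `-(ρ / d) • P(0)`, because `X` lies in the half-space
`⟪P(0), y⟫ ≥ d ^ 2`. Hence the extrema over `S_r` are `(d - ρ) ^ 2` and `(d + ρ) ^ 2`.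

As functions of `s = ‖x‖ ^ 2` the two bounds `(d ∓ √s) ^ 2` are respectively convex and concave, so
they are separated from their values at `s = r` by tangent lines. This yields Lagrange multipliers
valid on the whole space:
`(d - ρ) ^ 2 + (1 - d / ρ) * (‖x‖ ^ 2 - r) ≤ φ(x) ≤ (d + ρ) ^ 2 + (1 + d / ρ) * (‖x‖ ^ 2 - r)`
(`tangent_le_sq_dist_proj` and `sq_dist_proj_le_tangent`). Integrated against `η` along a
`u ∈ U_{η,r}`, the multiplier terms vanish, which gives the two bounds over `U_{η,r}`; constant
functions with value in `S_r` attain them.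
-/

namespace MetricProjection

section Hilbert

variable {H : Type*} [NormedAddCommGroup H] [InnerProductSpace ℝ H] [CompleteSpace H] {X : Set H}

theorem norm_sub_proj_eq_infDist (hne : X.Nonempty) (hcl : IsClosed X) (hconv : Convex ℝ X)
    (x : H) : ‖x - proj X x‖ = Metric.infDist x X := by
  have h := isNearest_proj hne hcl hconv x
  refine le_antisymm ((Metric.le_infDist hne).2 fun y hy => ?_) ?_
  · rw [dist_eq_norm]
    exact h.2 y hy
  · rw [← dist_eq_norm]
    exact Metric.infDist_le_dist_of_mem h.1

/-- The variational inequality for the projection of `0`: `X` lies in a half-space at distance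
`‖P(0)‖` from the origin. -/
theorem sq_norm_proj_zero_le_inner (hne : X.Nonempty) (hcl : IsClosed X) (hconv : Convex ℝ X)
    {y : H} (hy : y ∈ X) : ‖proj X 0‖ ^ 2 ≤ inner ℝ (proj X 0) y := by
  obtain ⟨hp, h⟩ := isNearest_proj hne hcl hconv 0
  have : Nonempty X := ⟨⟨_, hp⟩⟩
  have key := (norm_eq_iInf_iff_real_inner_le_zero hconv hp).1
    (le_antisymm (le_ciInf fun y : X => h y y.2)
      (ciInf_le ⟨0, by rintro _ ⟨y, rfl⟩; exact norm_nonneg _⟩ (⟨_, hp⟩ : X))) y hy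
  rw [zero_sub, inner_neg_left, inner_sub_right, real_inner_self_eq_norm_sq] at key
  linarith

theorem norm_sub_proj_le (hne : X.Nonempty) (hcl : IsClosed X) (hconv : Convex ℝ X) (x : H) :
    ‖x - proj X x‖ ≤ ‖proj X 0‖ + ‖x‖ := by
  have h := (isNearest_proj hne hcl hconv x).2 _ (isNearest_proj hne hcl hconv 0).1
  linarith [norm_sub_le x (proj X 0)]

theorem le_norm_sub_proj (hne : X.Nonempty) (hcl : IsClosed X) (hconv : Convex ℝ X) (x : H) :
    ‖proj X 0‖ - ‖x‖ ≤ ‖x - proj X x‖ := by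
  have h := (isNearest_proj hne hcl hconv 0).2 _ (isNearest_proj hne hcl hconv x).1
  rw [zero_sub, zero_sub, norm_neg, norm_neg] at h
  linarith [norm_le_norm_add_norm_sub x (proj X x)]

/-- The Lagrange multiplier bound for the infimum. -/
theorem tangent_le_sq_dist_proj (hne : X.Nonempty) (hcl : IsClosed X) (hconv : Convex ℝ X)
    {ρ : ℝ} (hρ : 0 < ρ) (hρd : ρ ≤ ‖proj X 0‖) (x : H) :
    (‖proj X 0‖ - ρ) ^ 2 + (1 - ‖proj X 0‖ / ρ) * (‖x‖ ^ 2 - ρ ^ 2) ≤ ‖x - proj X x‖ ^ 2 := by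
  have hx := le_norm_sub_proj hne hcl hconv x
  have hn := norm_nonneg (x - proj X x)
  set d := ‖proj X 0‖
  rcases le_total ‖x‖ d with hxd | hxd
  · have h1 : (d - ‖x‖) ^ 2 ≤ ‖x - proj X x‖ ^ 2 := by gcongr
    have h2 : (d - ρ) ^ 2 + (1 - d / ρ) * (‖x‖ ^ 2 - ρ ^ 2)
        = (d - ‖x‖) ^ 2 - d / ρ * (‖x‖ - ρ) ^ 2 := by field_simp; ring
    have h3 : 0 ≤ d / ρ * (‖x‖ - ρ) ^ 2 := by positivity
    linarith
  · -- The slope is nonpositive, so beyond `‖x‖ = d` the tangent stays below its value there,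
    -- which is at most `0`.
    have h1 : 0 ≤ d / ρ - 1 := by rw [sub_nonneg, one_le_div hρ]; exact hρd
    have h2 : d ^ 2 ≤ ‖x‖ ^ 2 := by gcongr
    have h3 := mul_le_mul_of_nonneg_left h2 h1
    have h4 : (d - ρ) ^ 2 + (1 - d / ρ) * (d ^ 2 - ρ ^ 2) = - (d / ρ * (d - ρ) ^ 2) := by
      field_simp; ring
    have h5 : 0 ≤ d / ρ * (d - ρ) ^ 2 := by positivity
    nlinarith [sq_nonneg ‖x - proj X x‖]

/-- The Lagrange multiplier bound for the supremum. -/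
theorem sq_dist_proj_le_tangent (hne : X.Nonempty) (hcl : IsClosed X) (hconv : Convex ℝ X)
    {ρ : ℝ} (hρ : 0 < ρ) (x : H) :
    ‖x - proj X x‖ ^ 2 ≤ (‖proj X 0‖ + ρ) ^ 2 + (1 + ‖proj X 0‖ / ρ) * (‖x‖ ^ 2 - ρ ^ 2) := by
  have hx := norm_sub_proj_le hne hcl hconv x
  set d := ‖proj X 0‖
  have h1 : ‖x - proj X x‖ ^ 2 ≤ (d + ‖x‖) ^ 2 := by gcongr
  have h2 : (d + ρ) ^ 2 + (1 + d / ρ) * (‖x‖ ^ 2 - ρ ^ 2)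
      = (d + ‖x‖) ^ 2 + d / ρ * (‖x‖ - ρ) ^ 2 := by field_simp; ring
  have h3 : 0 ≤ d / ρ * (‖x‖ - ρ) ^ 2 := by positivity
  linarith

theorem exists_norm_eq_norm_sub_proj_eq_sub (hne : X.Nonempty) (hcl : IsClosed X)
    (hconv : Convex ℝ X) {ρ : ℝ} (hρ : 0 < ρ) (hρd : ρ ≤ ‖proj X 0‖) :
    ∃ x : H, ‖x‖ = ρ ∧ ‖x - proj X x‖ = ‖proj X 0‖ - ρ := by
  have hd : 0 < ‖proj X 0‖ := hρ.trans_le hρd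
  have hnorm : ‖(ρ / ‖proj X 0‖) • proj X 0‖ = ρ := by
    rw [norm_smul, Real.norm_of_nonneg (by positivity)]
    field_simp
  refine ⟨(ρ / ‖proj X 0‖) • proj X 0, hnorm, le_antisymm ?_ ?_⟩
  · refine ((isNearest_proj hne hcl hconv _).2 _ (isNearest_proj hne hcl hconv 0).1).trans_eq ?_
    have h : (ρ / ‖proj X 0‖) • proj X 0 - proj X 0 = -((1 - ρ / ‖proj X 0‖) • proj X 0) := by
      module
    rw [h, norm_neg, norm_smul, Real.norm_of_nonneg (sub_nonneg.2 ((div_le_one hd).2 hρd))]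
    field_simp
  · simpa only [hnorm] using le_norm_sub_proj hne hcl hconv ((ρ / ‖proj X 0‖) • proj X 0)

theorem exists_norm_eq_norm_sub_proj_eq_add (hne : X.Nonempty) (hcl : IsClosed X)
    (hconv : Convex ℝ X) {ρ : ℝ} (hρ : 0 < ρ) (hd : 0 < ‖proj X 0‖) :
    ∃ x : H, ‖x‖ = ρ ∧ ‖x - proj X x‖ = ‖proj X 0‖ + ρ := by
  have hnorm : ‖-((ρ / ‖proj X 0‖) • proj X 0)‖ = ρ := by
    rw [norm_neg, norm_smul, Real.norm_of_nonneg (by positivity)]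
    field_simp
  refine ⟨-((ρ / ‖proj X 0‖) • proj X 0), hnorm, le_antisymm ?_ ?_⟩
  · simpa only [hnorm] using norm_sub_proj_le hne hcl hconv (-((ρ / ‖proj X 0‖) • proj X 0))
  · set x := -((ρ / ‖proj X 0‖) • proj X 0) with hx
    have h1 := sq_norm_proj_zero_le_inner hne hcl hconv (isNearest_proj hne hcl hconv x).1
    have h2 : inner ℝ (proj X 0) x = -(ρ * ‖proj X 0‖) := by
      rw [hx, inner_neg_right, real_inner_smul_right, real_inner_self_eq_norm_sq]
      field_simp
    have h3 := real_inner_le_norm (proj X 0) (proj X x - x)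
    rw [inner_sub_right, h2, norm_sub_rev] at h3
    refine le_of_mul_le_mul_left ?_ hd
    linarith

end Hilbert

section Integration

variable {T : Type*} [MeasurableSpace T] {μ : Measure T}
variable {H : Type*} [NormedAddCommGroup H]

theorem integrable_linfty_mul (η : Lp ℝ ⊤ μ) {f : T → ℝ} (hf : Integrable f μ) :
    Integrable (fun t => η t * f t) μ :=
  hf.mul_of_top_right (Lp.memLp η)

/-- Integrated over the constraint set, the multiplier term of an affine minorant in `‖x‖ ^ 2`
vanishes. -/
theorem mul_integral_le_of_le_affine {p : ℝ} {η : Lp ℝ ⊤ μ} (hη : 0 ≤ η) {r a c : ℝ} {f : H → ℝ}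
    (hf : ∀ x, a + c * (‖x‖ ^ 2 - r) ≤ f x) {u : Lp H (ENNReal.ofReal p) μ}
    (hu : u ∈ constraintSet p η r) (hηi : Integrable (fun t => η t) μ)
    (hui : Integrable (fun t => η t * ‖u t‖ ^ 2) μ)
    (hfi : Integrable (fun t => η t * f (u t)) μ) :
    a * ∫ t, η t ∂μ ≤ ∫ t, η t * f (u t) ∂μ := by
  have hu' : ∫ t, η t * ‖u t‖ ^ 2 ∂μ = r * ∫ t, η t ∂μ := hu
  calc a * ∫ t, η t ∂μ
      = ∫ t, (a - c * r) * η t + c * (η t * ‖u t‖ ^ 2) ∂μ := by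
        rw [integral_add (hηi.const_mul _) (hui.const_mul _), integral_const_mul,
          integral_const_mul, hu']
        ring
    _ ≤ ∫ t, η t * f (u t) ∂μ := by
        refine integral_mono_ae ((hηi.const_mul _).add (hui.const_mul _)) hfi ?_
        filter_upwards [(Lp.coeFn_nonneg η).2 hη] with t ht
        have := mul_le_mul_of_nonneg_left (hf (u t)) ht
        linarith

theorem integral_le_mul_of_le_affine {p : ℝ} {η : Lp ℝ ⊤ μ} (hη : 0 ≤ η) {r a c : ℝ} {f : H → ℝ}
    (hf : ∀ x, f x ≤ a + c * (‖x‖ ^ 2 - r)) {u : Lp H (ENNReal.ofReal p) μ}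
    (hu : u ∈ constraintSet p η r) (hηi : Integrable (fun t => η t) μ)
    (hui : Integrable (fun t => η t * ‖u t‖ ^ 2) μ)
    (hfi : Integrable (fun t => η t * f (u t)) μ) :
    ∫ t, η t * f (u t) ∂μ ≤ a * ∫ t, η t ∂μ := by
  have h := mul_integral_le_of_le_affine (f := fun x => -f x) (a := -a) (c := -c) hη
    (fun x => by linarith [hf x]) hu hηi hui (by simpa using hfi.neg)
  simp only [mul_neg, integral_neg] at h
  linarith

/-- Constant functions with value in `S_r` belong to the constraint set. -/
theorem exists_mem_constraintSet_integral_eq [IsFiniteMeasure μ] (p : ℝ) (η : Lp ℝ ⊤ μ) {r : ℝ}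
    {x : H} (hx : x ∈ sphereSq H r) (f : H → ℝ) :
    ∃ u ∈ constraintSet (H := H) p η r, ∫ t, η t * f (u t) ∂μ = f x * ∫ t, η t ∂μ := by
  have hu := (memLp_const (μ := μ) (p := ENNReal.ofReal p) x).coeFn_toLp
  have key (g : H → ℝ) : ∫ t, η t * g ((memLp_const (μ := μ) (p := ENNReal.ofReal p) x).toLp _ t) ∂μ
      = g x * ∫ t, η t ∂μ := by
    rw [← integral_const_mul]
    refine integral_congr_ae ?_
    filter_upwards [hu] with t ht
    rw [ht, mul_comm]
  refine ⟨_, ?_, key f⟩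
  have h := key (fun y => ‖y‖ ^ 2)
  rwa [show ‖x‖ ^ 2 = r from hx] at h

theorem integrable_mul_sq_norm_sub_proj [IsFiniteMeasure μ] [InnerProductSpace ℝ H]
    [CompleteSpace H] {X : Set H} (hne : X.Nonempty) (hcl : IsClosed X) (hconv : Convex ℝ X)
    (η : Lp ℝ ⊤ μ) {u : T → H} (hu : MemLp u 2 μ) :
    Integrable (fun t => η t * ‖u t - proj X (u t)‖ ^ 2) μ := by
  refine integrable_linfty_mul η ?_
  have hb : MemLp (fun t => ‖proj X 0‖ + ‖u t‖) 2 μ := (memLp_const ‖proj X 0‖).add hu.norm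
  refine MemLp.integrable_sq (hb.mono' ?_ (.of_forall fun t => ?_))
  · have hc : Continuous fun x => ‖x - proj X x‖ := by
      simpa only [norm_sub_proj_eq_infDist hne hcl hconv] using Metric.continuous_infDist_pt X
    exact hc.comp_aestronglyMeasurable hu.1
  · rw [norm_norm]
    exact norm_sub_proj_le hne hcl hconv _

end Integration

end MetricProjection

theorem theorem3
    {H : Type*} [NormedAddCommGroup H] [InnerProductSpace ℝ H] [CompleteSpace H]
    (X : Set H) (hne : X.Nonempty) (hcl : IsClosed X) (hconv : Convex ℝ X)
    (h0 : (0 : H) ∉ X)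
    {T : Type*} [MeasurableSpace T] (μ : Measure T)
    (hμ_pos : 0 < μ Set.univ) (hμ_fin : μ Set.univ < ⊤)
    (η : Lp ℝ ⊤ μ) (hη : 0 ≤ η)
    (r : ℝ) (hr : r ∈ Set.Ioo (0 : ℝ) (‖MetricProjection.proj X 0‖ ^ 2))
    (p : ℝ) (hp : 2 ≤ p) :
    -- all the integrals involved are those of integrable functions
    Integrable (fun t => η t) μ ∧
    (∀ u : Lp H (ENNReal.ofReal p) μ,
      Integrable (fun t => η t * ‖u t‖ ^ 2) μ ∧
      Integrable (fun t => η t * ‖u t - MetricProjection.proj X (u t)‖ ^ 2) μ) ∧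
    -- `m` and `M` are the infimum and the supremum of `‖x - P(x)‖²` on `S_r`
    ∃ m M : ℝ,
      IsGLB ((fun x : H => ‖x - MetricProjection.proj X x‖ ^ 2) ''
        MetricProjection.sphereSq H r) m ∧
      IsLUB ((fun x : H => ‖x - MetricProjection.proj X x‖ ^ 2) ''
        MetricProjection.sphereSq H r) M ∧
      IsGLB ((fun u : Lp H (ENNReal.ofReal p) μ =>
          ∫ t, η t * ‖u t - MetricProjection.proj X (u t)‖ ^ 2 ∂μ) ''
        MetricProjection.constraintSet p η r) (m * ∫ t, η t ∂μ) ∧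
      IsLUB ((fun u : Lp H (ENNReal.ofReal p) μ =>
          ∫ t, η t * ‖u t - MetricProjection.proj X (u t)‖ ^ 2 ∂μ) ''
        MetricProjection.constraintSet p η r) (M * ∫ t, η t ∂μ) := by
  have : IsFiniteMeasure μ := ⟨hμ_fin⟩
  have hηi : Integrable (fun t => η t) μ := (Lp.memLp η).integrable le_top
  have hmem (u : Lp H (ENNReal.ofReal p) μ) : MemLp u 2 μ :=
    (Lp.memLp u).mono_exponent (by
      rw [← ENNReal.ofReal_ofNat]
      exact ENNReal.ofReal_le_ofReal hp)
  have hui (u : Lp H (ENNReal.ofReal p) μ) : Integrable (fun t => η t * ‖u t‖ ^ 2) μ :=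
    MetricProjection.integrable_linfty_mul η (hmem u).norm.integrable_sq
  have hfi (u : Lp H (ENNReal.ofReal p) μ) :
      Integrable (fun t => η t * ‖u t - MetricProjection.proj X (u t)‖ ^ 2) μ :=
    MetricProjection.integrable_mul_sq_norm_sub_proj hne hcl hconv η (hmem u)
  refine ⟨hηi, fun u => ⟨hui u, hfi u⟩, ?_⟩
  obtain ⟨ρ, hρ, rfl⟩ : ∃ ρ : ℝ, 0 < ρ ∧ ρ ^ 2 = r :=
    ⟨√r, Real.sqrt_pos.2 hr.1, Real.sq_sqrt hr.1.le⟩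
  have hρd : ρ ≤ ‖MetricProjection.proj X 0‖ := (lt_of_pow_lt_pow_left₀ 2 (norm_nonneg _) hr.2).le
  have hlow := MetricProjection.tangent_le_sq_dist_proj hne hcl hconv hρ hρd
  have hupp := MetricProjection.sq_dist_proj_le_tangent hne hcl hconv hρ
  obtain ⟨a, haρ, ha⟩ :=
    MetricProjection.exists_norm_eq_norm_sub_proj_eq_sub hne hcl hconv hρ hρd
  obtain ⟨b, hbρ, hb⟩ :=
    MetricProjection.exists_norm_eq_norm_sub_proj_eq_add hne hcl hconv hρ (hρ.trans_le hρd)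
  have haS : a ∈ MetricProjection.sphereSq H (ρ ^ 2) := congrArg (· ^ 2) haρ
  have hbS : b ∈ MetricProjection.sphereSq H (ρ ^ 2) := congrArg (· ^ 2) hbρ
  refine ⟨(‖MetricProjection.proj X 0‖ - ρ) ^ 2, (‖MetricProjection.proj X 0‖ + ρ) ^ 2,
    IsLeast.isGLB ⟨⟨a, haS, by simp only [ha]⟩, ?_⟩,
    IsGreatest.isLUB ⟨⟨b, hbS, by simp only [hb]⟩, ?_⟩,
    IsLeast.isGLB ⟨?_, ?_⟩, IsGreatest.isLUB ⟨?_, ?_⟩⟩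
  · rintro _ ⟨x, hx, rfl⟩
    simpa [show ‖x‖ ^ 2 = ρ ^ 2 from hx] using hlow x
  · rintro _ ⟨x, hx, rfl⟩
    simpa [show ‖x‖ ^ 2 = ρ ^ 2 from hx] using hupp x
  · obtain ⟨u, hu, h⟩ := MetricProjection.exists_mem_constraintSet_integral_eq (μ := μ) p η haS
      (fun x => ‖x - MetricProjection.proj X x‖ ^ 2)
    exact ⟨u, hu, by simpa only [ha] using h⟩
  · rintro _ ⟨u, hu, rfl⟩
    exact MetricProjection.mul_integral_le_of_le_affine hη hlow hu hηi (hui u) (hfi u)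
  · obtain ⟨u, hu, h⟩ := MetricProjection.exists_mem_constraintSet_integral_eq (μ := μ) p η hbS
      (fun x => ‖x - MetricProjection.proj X x‖ ^ 2)
    exact ⟨u, hu, by simpa only [hb] using h⟩
  · rintro _ ⟨u, hu, rfl⟩
    exact MetricProjection.integral_le_mul_of_le_affine hη hupp hu hηi (hui u) (hfi u)
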